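/- Let $d\ge 1$, $\lambda>0$, $\tau>0$, $c>0$, and let $\mu_0,\mu_1\ge 0$ with $\mu_0+\mu_1>0$. Let $X_1,X_2,\dots$ be the points of a stationary Poisson process of intensity $\lambda$ in $\mathbb{R}^d$. Let $C_1,C_2,\dots$ be i.i.d. random closed sets in $\mathbb{R}^d$ such that almost surely $C_i$ is contained in the closed ball of radius $\tau$ about the origin and has positive Lebesgue measure $\|C_i\|$; put $\beta=\mathbb{E}\|C_1\|$. Let $(Y_i^t)_{t\ge 0}$, $i\ge 1$, be i.i.d. $\{0,1\}$-valued stationary continuous-time Markov processes (with càdlàg paths) that jump from $0$ to $1$ at rate $\mu_0$ and from $1$ to $0$ at rate $\mu_1$, so that $p_1:=\mathbb{P}(Y_i^t=1)=\mu_0/(\mu_0+\mu_1)$. Assume that the sequences $(X_i)$, $(C_i)$ and $(Y_i)$ are independent of each other. (This is the unscaled Markov-Poisson-Boolean model: at time $t$ the available sensors cover the sets $X_i+C_i$ with $Y_i^t=1$.) A target moves along a straight line with constant speed $c$; at time $s\ge 0$ it is at $\underline{s}=a+cs\,u$, where $a,u\in\mathbb{R}^d$ and $|u|=1$. Let $\zeta(s)=1$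 if there is an $i$ with $Y_i^s=1$ and $\underline{s}\in X_i+C_i$, and $\zeta(s)=0$ otherwise, and let $$V_T=\int_0^T(1-\zeta(s))\,ds$$ be the length of time in $[0,T]$ during which the target is not covered. Then, as $T\to\infty$, $$\frac{V_T}{T}\longrightarrow e^{-p_1\lambda\beta}\qquad\text{almost surely};$$ equivalently, per unit of length $L=cT$ of the path, $V_T/L\to e^{-p_1\lambda\beta}/c$ almost surely. -/

import Mathlib

open MeasureTheory ProbabilityTheory Filter Topology Set TopologicalSpace
open scoped NNReal ENNReal Pointwise

/-- Euclidean space `ℝ^d`. -/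
abbrev Space (d : ℕ) : Type := EuclideanSpace ℝ (Fin d)

/-- The (Fell) σ-algebra on the closed subsets of `ℝ^d`, generated by the hitting events
`{F | F ∩ K ≠ ∅}` with `K` compact. A random closed set is a measurable map into this space. -/
instance instMeasurableSpaceClosedsSpace (d : ℕ) : MeasurableSpace (Closeds (Space d)) :=
  MeasurableSpace.generateFrom
    {S | ∃ K : Set (Space d), IsCompact K ∧ S = {F : Closeds (Space d) | ((F : Set (Space d)) ∩ K).Nonempty}}

section Models

variable {Ω : Type*} [MeasurableSpace Ω]

/-- The number of points `X i` (counted with multiplicity) that lie in `A`. -/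
noncomputable def pointCount {d : ℕ} (X : ℕ → Ω → Space d) (A : Set (Space d)) (ω : Ω) : ℕ∞ :=
  {i : ℕ | X i ω ∈ A}.encard

/-- `X 0, X 1, …` is a measurable enumeration of the points of a stationary Poisson point process
of intensity `lam` on `ℝ^d`: the number of points in a Borel set `A` of finite volume is Poisson
distributed with mean `lam * ‖A‖`, and the numbers of points in finitely many pairwise disjoint
Borel sets of finite volume are independent. -/
structure IsPoissonProcess (P : Measure Ω) {d : ℕ} (lam : ℝ) (X : ℕ → Ω → Space d) : Prop where
  measurable : ∀ i, Measurable (X i)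
  law : ∀ A : Set (Space d), MeasurableSet A → volume A < ∞ → ∀ k : ℕ,
    P {ω | pointCount X A ω = k} =
      ENNReal.ofReal (Real.exp (-(lam * volume.real A)) * (lam * volume.real A) ^ k
        / (Nat.factorial k : ℝ))
  indep : ∀ (n : ℕ) (A : Fin n → Set (Space d)), (∀ j, MeasurableSet (A j)) →
    (∀ j, volume (A j) < ∞) → Pairwise (fun j l => Disjoint (A j) (A l)) →
    iIndepFun (fun j => pointCount X (A j)) P

/-- The generator (`Q`-matrix) of the chain on `{0, 1}` that jumps from `0` to `1` at rate `mu0`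
and from `1` to `0` at rate `mu1`. -/
def onOffGenerator (mu0 mu1 : ℝ) : Matrix (Fin 2) (Fin 2) ℝ :=
  !![-mu0, mu0; mu1, -mu1]

/-- `Y` is a stationary continuous-time Markov process with values in `{0, 1}`, with càdlàg paths
and with jump rates `mu0` (from `0` to `1`) and `mu1` (from `1` to `0`). -/
structure IsStationaryOnOff (P : Measure Ω) (mu0 mu1 : ℝ) (Y : ℝ≥0 → Ω → Fin 2) : Prop where
  measurable : ∀ t, Measurable (Y t)
  cadlag : ∀ᵐ ω ∂P, ∀ t : ℝ≥0,
    ContinuousWithinAt (fun s => Y s ω) (Ici t) t ∧ ∃ l, Tendsto (fun s => Y s ω) (𝓝[<] t) (𝓝 l)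
  markov : ∀ (n : ℕ) (t : Fin (n + 1) → ℝ≥0), StrictMono t → ∀ j : Fin (n + 1) → Fin 2,
    P.real {ω | ∀ k, Y (t k) ω = j k} =
      P.real {ω | Y (t 0) ω = j 0} *
        ∏ k : Fin n,
          NormedSpace.exp (((t k.succ : ℝ) - (t k.castSucc : ℝ)) • onOffGenerator mu0 mu1)
            (j k.castSucc) (j k.succ)
  stationary : ∀ (t : ℝ≥0) (j : Fin 2), P.real {ω | Y t ω = j} = P.real {ω | Y 0 ω = j}

/-- The Markov-Poisson-Boolean model `{Y_i^t (X_i + C_i), i ≥ 1}`, `t ≥ 0`: the `X_i` are the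
points of a stationary Poisson process of intensity `lam`, the shapes `C_i` are i.i.d. random closed
sets with law `nu`, the `Y_i` are i.i.d. stationary on-off Markov processes with rates `mu0`, `mu1`
(their common law is determined by these rates), and the three sequences are independent. -/
structure IsMPB (P : Measure Ω) {d : ℕ} (lam : ℝ) (nu : Measure (Closeds (Space d)))
    (mu0 mu1 : ℝ) (X : ℕ → Ω → Space d) (C : ℕ → Ω → Closeds (Space d))
    (Y : ℕ → ℝ≥0 → Ω → Fin 2) : Prop where
  poisson : IsPoissonProcess P lam X
  shape_measurable : ∀ i, Measurable (C i)
  shape_law : ∀ i, P.map (C i) = nu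
  shape_indep : iIndepFun C P
  onOff : ∀ i, IsStationaryOnOff P mu0 mu1 (Y i)
  onOff_indep : iIndepFun (fun i ω => (fun t => Y i t ω : ℝ≥0 → Fin 2)) P
  shape_onOff_indep :
    IndepFun (fun ω => (fun i => C i ω : ℕ → Closeds (Space d)))
      (fun ω => (fun i t => Y i t ω : ℕ → ℝ≥0 → Fin 2)) P
  point_mark_indep :
    IndepFun (fun ω => (fun i => X i ω : ℕ → Space d))
      (fun ω => ((fun i => C i ω, fun i t => Y i t ω) :
        (ℕ → Closeds (Space d)) × (ℕ → ℝ≥0 → Fin 2))) P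

/-- The position at time `s` of a target that starts at `a` at time `0` and moves with speed `c` in
the direction of the unit vector `u`. -/
noncomputable def targetPos {d : ℕ} (a u : Space d) (c : ℝ) (s : ℝ≥0) : Space d :=
  a + (c * (s : ℝ)) • u

open Classical in
/-- `ζ(s)`: the indicator that the target is covered at time `s` by at least one of the sets
`X_i + C_i` whose sensor is on at time `s`. -/
noncomputable def coverIndicator {d : ℕ} (X : ℕ → Ω → Space d) (C : ℕ → Ω → Closeds (Space d))
    (Y : ℕ → ℝ≥0 → Ω → Fin 2) (a u : Space d) (c : ℝ) (s : ℝ≥0) (ω : Ω) : ℝ :=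
  if ∃ i, Y i s ω = 1 ∧ targetPos a u c s ∈ X i ω +ᵥ (C i ω : Set (Space d)) then 1 else 0

/-- `V_T = ∫_0^T (1 - ζ(s)) ds`: the time in `[0, T]` during which the target is not covered. -/
noncomputable def vacancyTime {d : ℕ} (X : ℕ → Ω → Space d) (C : ℕ → Ω → Closeds (Space d))
    (Y : ℕ → ℝ≥0 → Ω → Fin 2) (a u : Space d) (c T : ℝ) (ω : Ω) : ℝ :=
  ∫ s in (0 : ℝ)..T, (1 - coverIndicator X C Y a u c s.toNNReal ω)

end Models

/-! The sensors form an independently marked Poisson process. A sensor located at `x` is on and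
covers a given point `p` with probability `p1 * coverProb nu (p - x)`, and the integral of this over
`x` is `p1 * beta` by Fubini. The probability that no sensor covers `p` is therefore `exp (-(p1 *
lam * beta))` at every time, which fixes the mean of `V_T / T`.

For almost sure convergence the decisive point is that shapes lie in a ball of radius `tau`, so no
single sensor can cover two points more than `2 * tau` apart. The void probability of the pair of
points then factorises exactly (`IsMPB.measureReal_vacantEvent_inter`), whatever the dependence
between the states of one sensor at two times. Since the target moves at speed `c`, the vacancy
indicators at times more than `2 * tau / c` apart are uncorrelated; no mixing of the on-off chains
is used. Hence the variance of `V_T` is `O(T)`, averages converge along `T = n ^ 2` by summability,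
and boundedness fills the gaps (`ae_tendsto_integral_div`).

The void probabilities (`IsPoissonProcess.measureReal_forall_notMem`) come from the generating
functional `E ∏ (1 - h (X i)) = exp (-lam ∫ h)`: step functions reduce it to independent Poisson
counts, and a limit gives measurable `h`. Integrating over time needs joint measurability, which
right-continuity of the on-off paths supplies. -/

/-! ### Generating functional and void probabilities of Poisson processes -/

/-- If finitely many points lie in the disjoint union of the `A j`, the product over all points of
a step function depends only on the point counts. -/
theorem prod_one_sub_step {Ω : Type*} {d n : ℕ} {X : ℕ → Ω → Space d}
    {A : Fin n → Set (Space d)} {ω : Ω} {h : Space d → ℝ}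
    {y : Fin n → ℝ} (hd : Pairwise fun j l => Disjoint (A j) (A l))
    (hy : ∀ j, ∀ x ∈ A j, h x = y j) (h0 : ∀ x, (∀ j, x ∉ A j) → h x = 0)
    {S : Finset ℕ} (hS : ∀ i j, X i ω ∈ A j → i ∈ S) :
    ∏ i ∈ S, (1 - h (X i ω)) = ∏ j, (1 - y j) ^ (pointCount X (A j) ω).toNat := by
  classical
  -- At most one factor on the right differs from one, by disjointness. After the two products are
  -- exchanged, each cell contributes a power of its own constant.
  have key (i : ℕ) : 1 - h (X i ω) = ∏ j, if X i ω ∈ A j then (1 - y j) else 1 := by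
    by_cases hi : ∃ j, X i ω ∈ A j
    · obtain ⟨j, hj⟩ := hi
      rw [Finset.prod_eq_single j, if_pos hj, hy j _ hj]
      · intro l _ hl
        rw [if_neg]
        exact fun hl' => Set.disjoint_left.1 (hd hl) hl' hj
      · simp
    · push Not at hi
      rw [h0 _ hi, Finset.prod_eq_one]
      · simp
      · intro j _; rw [if_neg (hi j)]
  simp_rw [key]
  rw [Finset.prod_comm]
  refine Finset.prod_congr rfl fun j _ => ?_
  rw [Finset.prod_ite, Finset.prod_const, Finset.prod_const_one, mul_one]
  congr 1
  have : {i : ℕ | X i ω ∈ A j} = ↑(S.filter fun i => X i ω ∈ A j) := by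
    ext i
    simpa using hS i j
  rw [pointCount, this, Set.encard_coe_eq_coe_finsetCard, ENat.toNat_natCast]

section PoissonFunctional

variable {Ω : Type*} [MeasurableSpace Ω] {P : Measure Ω} {d : ℕ} {lam : ℝ}
  {X : ℕ → Ω → Space d}

theorem measurable_pointCount (hX : ∀ i, Measurable (X i)) {A : Set (Space d)}
    (hA : MeasurableSet A) : Measurable (pointCount X A) := by
  refine measurable_encard.comp ?_
  rw [measurable_set_iff]
  exact fun i => measurableSet_setOfPred.1 (hX i hA)

/-- The Poisson weights sum to one, so the finite values already exhaust the whole mass of the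
count. -/
theorem IsPoissonProcess.ae_pointCount_ne_top [IsProbabilityMeasure P]
    (h : IsPoissonProcess P lam X) (hlam : 0 ≤ lam) {A : Set (Space d)} (hA : MeasurableSet A)
    (hA' : volume A < ∞) : ∀ᵐ ω ∂P, pointCount X A ω ≠ ⊤ := by
  have hm := measurable_pointCount h.measurable hA
  have hU : {ω | pointCount X A ω ≠ ⊤} = ⋃ k : ℕ, {ω | pointCount X A ω = k} := by
    ext ω
    simp only [mem_ofPred_eq, mem_iUnion]
    constructor
    · intro hω
      exact ⟨_, (ENat.natCast_toNat hω).symm⟩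
    · rintro ⟨k, hk⟩
      simp [hk]
  have hmeas (k : ℕ) : MeasurableSet {ω | pointCount X A ω = k} :=
    hm (measurableSet_singleton (k : ℕ∞))
  have h1 : P {ω | pointCount X A ω ≠ ⊤} = 1 := by
    rw [hU, measure_iUnion _ hmeas]
    · have hr : ((lam * volume.real A).toNNReal : ℝ) = lam * volume.real A :=
        Real.coe_toNNReal _ (by positivity)
      calc ∑' k : ℕ, P {ω | pointCount X A ω = k}
          = ∑' k : ℕ, poissonMeasure (lam * volume.real A).toNNReal {k} := by
            congr 1; ext k
            rw [h.law A hA hA' k, poissonMeasure_singleton, hr]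
        _ = poissonMeasure (lam * volume.real A).toNNReal univ := by
            rw [← measure_iUnion]
            · rw [iUnion_of_singleton]
            · intro i j hij
              simpa using hij
            · simp
        _ = 1 := measure_univ
    · intro i j hij
      rw [Function.onFun, Set.disjoint_left]
      intro ω h1 h2
      exact hij (by exact_mod_cast (h1.symm.trans h2 : (i : ℕ∞) = j))
  have h2 : MeasurableSet {ω | pointCount X A ω ≠ ⊤} := by
    rw [hU]; exact MeasurableSet.iUnion hmeas
  rw [← prob_compl_eq_zero_iff h2] at h1
  exact h1

theorem IsPoissonProcess.map_toNat_pointCount [IsProbabilityMeasure P]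
    (h : IsPoissonProcess P lam X) {r : ℝ≥0} (hlam : 0 ≤ lam) {A : Set (Space d)}
    (hA : MeasurableSet A) (hA' : volume A < ∞) (hr : (r : ℝ) = lam * volume.real A) :
    P.map (fun ω => (pointCount X A ω).toNat) = poissonMeasure r := by
  have hm : Measurable (fun ω => (pointCount X A ω).toNat) :=
    (Measurable.of_discrete (f := ENat.toNat)).comp (measurable_pointCount h.measurable hA)
  refine Measure.ext_of_singleton fun k => ?_
  rw [Measure.map_apply hm (measurableSet_singleton k), poissonMeasure_singleton, hr,
    ← h.law A hA hA' k]
  refine measure_congr ?_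
  filter_upwards [h.ae_pointCount_ne_top hlam hA hA'] with ω hω
  apply propext
  change (pointCount X A ω).toNat = k ↔ pointCount X A ω = k
  constructor
  · intro hk
    rw [← hk, ENat.natCast_toNat hω]
  · intro hk
    rw [hk, ENat.toNat_natCast]

/-- The exponential series at `r * x`, multiplied by `exp (-r)`. -/
theorem integral_pow_poissonMeasure (r : ℝ≥0) (x : ℝ) :
    ∫ n, x ^ n ∂(poissonMeasure r) = Real.exp (-(r * (1 - x))) := by
  rw [integral_poissonMeasure]
  have := ((NormedSpace.expSeries_div_hasSum_exp ((r : ℝ) * x)).mul_left (Real.exp (-r))).tsum_eq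
  rw [← Real.exp_eq_exp_ℝ, ← Real.exp_add] at this
  rw [show -((r : ℝ) * (1 - x)) = -r + r * x by ring, ← this]
  congr 1; ext n
  rw [mul_pow, smul_eq_mul]; ring

theorem IsPoissonProcess.integral_pow_pointCount [IsProbabilityMeasure P]
    (h : IsPoissonProcess P lam X) (hlam : 0 ≤ lam) {A : Set (Space d)}
    (hA : MeasurableSet A) (hA' : volume A < ∞) (x : ℝ) :
    ∫ ω, x ^ (pointCount X A ω).toNat ∂P = Real.exp (-(lam * volume.real A * (1 - x))) := by
  have hm : Measurable (fun ω => (pointCount X A ω).toNat) :=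
    (Measurable.of_discrete (f := ENat.toNat)).comp (measurable_pointCount h.measurable hA)
  have hr : ((lam * volume.real A).toNNReal : ℝ) = lam * volume.real A :=
    Real.coe_toNNReal _ (by positivity)
  have := h.map_toNat_pointCount hlam hA hA' hr
  rw [← integral_map (φ := fun ω => (pointCount X A ω).toNat) (f := fun n => x ^ n)
    hm.aemeasurable (by fun_prop), this, integral_pow_poissonMeasure, hr]

theorem IsPoissonProcess.integral_prod_pow_pointCount [IsProbabilityMeasure P]
    (h : IsPoissonProcess P lam X) (hlam : 0 ≤ lam) {n : ℕ} {A : Fin n → Set (Space d)}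
    (hA : ∀ j, MeasurableSet (A j)) (hA' : ∀ j, volume (A j) < ∞)
    (hd : Pairwise fun j l => Disjoint (A j) (A l)) (y : Fin n → ℝ) :
    ∫ ω, ∏ j, (1 - y j) ^ (pointCount X (A j) ω).toNat ∂P =
      Real.exp (-(lam * ∑ j, y j * volume.real (A j))) := by
  rw [(h.indep n A hA hA' hd).integral_fun_prod_comp
    (f := fun j k => (1 - y j) ^ k.toNat)
    (fun j => (measurable_pointCount h.measurable (hA j)).aemeasurable)
    (fun j => (Measurable.of_discrete).aestronglyMeasurable)]
  simp_rw [h.integral_pow_pointCount hlam (hA _) (hA' _)]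
  rw [← Real.exp_sum]
  congr 1
  rw [Finset.mul_sum, ← Finset.sum_neg_distrib]
  refine Finset.sum_congr rfl fun j _ => ?_
  ring

end PoissonFunctional

/-- A step function is the sum of its constant pieces. -/
theorem step_eq_sum_indicator {α : Type*} {n : ℕ} {A : Fin n → Set α} {h : α → ℝ}
    {y : Fin n → ℝ} (hd : Pairwise fun j l => Disjoint (A j) (A l))
    (hy : ∀ j, ∀ x ∈ A j, h x = y j) (h0 : ∀ x, (∀ j, x ∉ A j) → h x = 0) (x : α) :
    h x = ∑ j, (A j).indicator (fun _ => y j) x := by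
  by_cases hi : ∃ j, x ∈ A j
  · obtain ⟨j, hj⟩ := hi
    rw [Finset.sum_eq_single j, indicator_of_mem hj, hy j _ hj]
    · intro l _ hl
      exact indicator_of_notMem (fun hl' => Set.disjoint_left.1 (hd hl) hl' hj) _
    · simp
  · push Not at hi
    rw [h0 _ hi, Finset.sum_eq_zero]
    intro j _
    exact indicator_of_notMem (hi j) _

theorem abs_floor_mul_div_sub_le {N : ℕ} (hN : 0 < N) {x : ℝ} (hx : 0 ≤ x) :
    |(⌊N * x⌋₊ : ℝ) / N - x| ≤ 1 / N := by
  have hN' : (0 : ℝ) < N := by exact_mod_cast hN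
  have h1 := Nat.floor_le (a := N * x) (by positivity)
  have h2 := Nat.lt_floor_add_one (N * x)
  rw [abs_le]
  constructor
  · rw [neg_le_sub_iff_le_add, ← add_div, le_div_iff₀ hN']; linarith
  · rw [sub_le_iff_le_add, div_le_iff₀ hN', add_mul, div_mul_cancel₀ _ hN'.ne']; linarith

theorem floor_mul_div_le {N : ℕ} (hN : 0 < N) {x : ℝ} (hx : 0 ≤ x) :
    (⌊N * x⌋₊ : ℝ) / N ≤ x := by
  have hN' : (0 : ℝ) < N := by exact_mod_cast hN
  rw [div_le_iff₀ hN', mul_comm x]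
  exact Nat.floor_le (by positivity)

theorem tendsto_floor_mul_div {x : ℝ} (hx : 0 ≤ x) :
    Tendsto (fun m : ℕ => (⌊((m + 1 : ℕ) : ℝ) * x⌋₊ : ℝ) / ((m + 1 : ℕ) : ℝ)) atTop (𝓝 x) := by
  rw [tendsto_iff_norm_sub_tendsto_zero]
  refine squeeze_zero (fun _ => norm_nonneg _)
    (fun m => abs_floor_mul_div_sub_le (Nat.succ_pos m) hx) ?_
  simpa using tendsto_one_div_add_atTop_nhds_zero_nat (𝕜 := ℝ)

section PoissonFunctional

variable {Ω : Type*} [MeasurableSpace Ω] {P : Measure Ω} {d : ℕ} {lam : ℝ}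
  {X : ℕ → Ω → Space d}

theorem IsPoissonProcess.ae_finite [IsProbabilityMeasure P]
    (hX : IsPoissonProcess P lam X) (hlam : 0 ≤ lam) {A : Set (Space d)} (hA : MeasurableSet A)
    (hA' : volume A < ∞) : ∀ᵐ ω ∂P, {i | X i ω ∈ A}.Finite := by
  filter_upwards [hX.ae_pointCount_ne_top hlam hA hA'] with ω hω
  exact Set.encard_ne_top_iff.1 hω

/-- Factors off `A` equal one, so when finitely many points lie in `A` the `finprod` is a genuine
finite product and not its default value. -/
theorem finprod_one_sub_eq {Ω : Type*} {d : ℕ} {X : ℕ → Ω → Space d} {A : Set (Space d)} {ω : Ω}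
    {h : Space d → ℝ} (hsupp : ∀ x ∉ A, h x = 0) {S : Finset ℕ} (hS : ∀ i, X i ω ∈ A → i ∈ S) :
    ∏ᶠ i, (1 - h (X i ω)) = ∏ i ∈ S, (1 - h (X i ω)) := by
  refine finprod_eq_prod_of_mulSupport_subset _ fun i hi => ?_
  by_contra hiS
  exact hi (by simp [hsupp _ fun hi' => hiS (hS i hi')])

theorem abs_prod_one_sub_le_one {ι : Type*} {S : Finset ι} {g : ι → ℝ} (h0 : ∀ i, 0 ≤ g i)
    (h1 : ∀ i, g i ≤ 1) : ‖∏ i ∈ S, (1 - g i)‖ ≤ 1 := by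
  rw [Real.norm_eq_abs, abs_of_nonneg (Finset.prod_nonneg fun i _ => sub_nonneg.2 (h1 i))]
  exact Finset.prod_le_one (fun i _ => sub_nonneg.2 (h1 i)) fun i _ => by linarith [h0 i]

/-- The probability generating functional of a Poisson process. -/
theorem IsPoissonProcess.integral_finprod_one_sub [IsProbabilityMeasure P]
    (hX : IsPoissonProcess P lam X) (hlam : 0 ≤ lam) {A : Set (Space d)} (hA : MeasurableSet A)
    (hA' : volume A < ∞) {h : Space d → ℝ} (hm : Measurable h) (h0 : ∀ x, 0 ≤ h x)
    (h1 : ∀ x, h x ≤ 1) (hsupp : ∀ x ∉ A, h x = 0) :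
    ∫ ω, ∏ᶠ i, (1 - h (X i ω)) ∂P = Real.exp (-(lam * ∫ x, h x)) := by
  -- Rounding `h` down to multiples of `1 / (m + 1)` gives step functions that converge to `h` and
  -- still vanish off `A`.
  set g : ℕ → Space d → ℝ := fun m x => (⌊((m + 1 : ℕ) : ℝ) * h x⌋₊ : ℝ) / ((m + 1 : ℕ) : ℝ)
    with hg
  have hgm (m : ℕ) : Measurable (g m) := by
    simp only [hg]; fun_prop
  have hg0 (m : ℕ) (x) : 0 ≤ g m x := by simp only [hg]; positivity
  have hgh (m : ℕ) (x) : g m x ≤ h x := floor_mul_div_le (Nat.succ_pos m) (h0 x)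
  have hg1 (m : ℕ) (x) : g m x ≤ 1 := (hgh m x).trans (h1 x)
  have hgs (m : ℕ) (x) (hx : x ∉ A) : g m x = 0 :=
    le_antisymm ((hgh m x).trans_eq (hsupp x hx)) (hg0 m x)
  have hgt (x) : Tendsto (fun m => g m x) atTop (𝓝 (h x)) := tendsto_floor_mul_div (h0 x)
  have hfin := hX.ae_finite hlam hA hA'
  -- The index `j` stands for the level `j + 1`: omitting level zero keeps every cell inside `A`,
  -- hence of finite volume.
  set B : (m : ℕ) → Fin (m + 1) → Set (Space d) :=
    fun m j => {x | ⌊((m + 1 : ℕ) : ℝ) * h x⌋₊ = (j : ℕ) + 1} with hB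
  have hBm (m : ℕ) (j) : MeasurableSet (B m j) :=
    (show Measurable fun x => ⌊((m + 1 : ℕ) : ℝ) * h x⌋₊ by fun_prop)
      (measurableSet_singleton ((j : ℕ) + 1))
  have hBA (m : ℕ) (j) : B m j ⊆ A := by
    intro x hx
    by_contra hxA
    have : ⌊((m + 1 : ℕ) : ℝ) * h x⌋₊ = (j : ℕ) + 1 := hx
    rw [hsupp x hxA] at this
    simp at this
  have hBv (m : ℕ) (j) : volume (B m j) < ∞ := (measure_mono (hBA m j)).trans_lt hA'
  have hBd (m : ℕ) : Pairwise fun j l => Disjoint (B m j) (B m l) := by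
    intro j l hjl
    rw [Set.disjoint_left]
    intro x hx hx'
    have : (j : ℕ) + 1 = l + 1 := Eq.trans (Eq.symm hx) hx'
    exact hjl (Fin.ext (by lia))
  have hBy (m : ℕ) (j) (x) (hx : x ∈ B m j) : g m x = ((j : ℕ) + 1 : ℕ) / ((m + 1 : ℕ) : ℝ) := by
    have : ⌊((m + 1 : ℕ) : ℝ) * h x⌋₊ = (j : ℕ) + 1 := hx
    simp only [hg, this]
  have hB0 (m : ℕ) (x) (hx : ∀ j, x ∉ B m j) : g m x = 0 := by
    have hle : ⌊((m + 1 : ℕ) : ℝ) * h x⌋₊ ≤ m + 1 := by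
      refine Nat.floor_le_of_le ?_
      exact mul_le_of_le_one_right (by positivity) (h1 x)
    have : ⌊((m + 1 : ℕ) : ℝ) * h x⌋₊ = 0 := by
      by_contra hne
      refine hx ⟨⌊((m + 1 : ℕ) : ℝ) * h x⌋₊ - 1, by lia⟩ ?_
      change _ = _ - 1 + 1
      lia
    simp only [hg, this]
    simp
  have hprod (m : ℕ) : (fun ω => ∏ᶠ i, (1 - g m (X i ω))) =ᵐ[P] fun ω =>
      ∏ j : Fin (m + 1), (1 - ((j : ℕ) + 1 : ℕ) / ((m + 1 : ℕ) : ℝ))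
        ^ (pointCount X (B m j) ω).toNat := by
    filter_upwards [hfin] with ω hω
    rw [finprod_one_sub_eq (hgs m) (S := hω.toFinset) (fun i hi => by simpa using hi)]
    exact prod_one_sub_step (hBd m) (hBy m) (hB0 m)
      (fun i j hi => hω.mem_toFinset.2 (hBA m j hi))
  have hint (m : ℕ) : ∫ x, g m x = ∑ j : Fin (m + 1), ((j : ℕ) + 1 : ℕ) / ((m + 1 : ℕ) : ℝ)
      * volume.real (B m j) := by
    have : g m = fun x => ∑ j, (B m j).indicator
        (fun _ => ((j : ℕ) + 1 : ℕ) / ((m + 1 : ℕ) : ℝ)) x :=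
      funext (step_eq_sum_indicator (hBd m) (hBy m) (hB0 m))
    rw [this, integral_finsetSum]
    · refine Finset.sum_congr rfl fun j _ => ?_
      rw [integral_indicator_const _ (hBm m j), smul_eq_mul, mul_comm]
    · intro j _
      exact (integrable_indicator_iff (hBm m j)).2 (integrableOn_const (hBv m j).ne)
  have hstep (m : ℕ) : ∫ ω, ∏ᶠ i, (1 - g m (X i ω)) ∂P = Real.exp (-(lam * ∫ x, g m x)) := by
    rw [integral_congr_ae (hprod m), hint,
      hX.integral_prod_pow_pointCount hlam (hBm m) (hBv m) (hBd m)]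
  have hlim1 : Tendsto (fun m => ∫ ω, ∏ᶠ i, (1 - g m (X i ω)) ∂P) atTop
      (𝓝 (∫ ω, ∏ᶠ i, (1 - h (X i ω)) ∂P)) := by
    refine tendsto_integral_of_dominated_convergence (fun _ => 1) ?_ (integrable_const _) ?_ ?_
    · intro m
      refine AEStronglyMeasurable.congr (Measurable.aestronglyMeasurable ?_) (hprod m).symm
      refine Finset.measurable_prod _ fun j _ => ?_
      exact (Measurable.of_discrete (f := fun k : ℕ∞ => (_ : ℝ) ^ k.toNat)).comp
        (measurable_pointCount hX.measurable (hBm m j))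
    · intro m
      filter_upwards [hfin] with ω hω
      rw [finprod_one_sub_eq (hgs m) (S := hω.toFinset) (fun i hi => by simpa using hi)]
      exact abs_prod_one_sub_le_one (fun i => hg0 m _) (fun i => hg1 m _)
    · filter_upwards [hfin] with ω hω
      rw [finprod_one_sub_eq hsupp (S := hω.toFinset) (fun i hi => by simpa using hi)]
      have (m : ℕ) := finprod_one_sub_eq (X := X) (hgs m) (S := hω.toFinset)
        (fun i hi => by simpa using hi)
      simp_rw [this]
      exact tendsto_finsetProd _ fun i _ => tendsto_const_nhds.sub (hgt _)
  have hlim2 : Tendsto (fun m => ∫ x, g m x) atTop (𝓝 (∫ x, h x)) := by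
    refine tendsto_integral_of_dominated_convergence (A.indicator fun _ => 1)
      (fun m => (hgm m).aestronglyMeasurable)
      ((integrable_indicator_iff hA).2 (integrableOn_const hA'.ne)) ?_ ?_
    · intro m
      refine Eventually.of_forall fun x => ?_
      rw [Real.norm_eq_abs, abs_of_nonneg (hg0 m x)]
      by_cases hx : x ∈ A
      · rw [indicator_of_mem hx]; exact hg1 m x
      · rw [indicator_of_notMem hx, hgs m x hx]
    · exact Eventually.of_forall hgt
  refine tendsto_nhds_unique hlim1 ?_
  simp_rw [hstep]
  exact (Real.continuous_exp.tendsto _).comp (hlim2.const_mul lam).neg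

/-- Independence of the marks yields product formulas over finitely many indices only, so the
functional is needed as a limit of truncations. Almost surely finitely many points lie in `A`, and
the partial products are eventually constant. -/
theorem IsPoissonProcess.tendsto_integral_prod_one_sub [IsProbabilityMeasure P]
    (hX : IsPoissonProcess P lam X) (hlam : 0 ≤ lam) {A : Set (Space d)} (hA : MeasurableSet A)
    (hA' : volume A < ∞) {h : Space d → ℝ} (hm : Measurable h) (h0 : ∀ x, 0 ≤ h x)
    (h1 : ∀ x, h x ≤ 1) (hsupp : ∀ x ∉ A, h x = 0) :
    Tendsto (fun n => ∫ ω, ∏ i ∈ Finset.range n, (1 - h (X i ω)) ∂P) atTop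
      (𝓝 (Real.exp (-(lam * ∫ x, h x)))) := by
  rw [← hX.integral_finprod_one_sub hlam hA hA' hm h0 h1 hsupp]
  refine tendsto_integral_of_dominated_convergence (fun _ => 1) ?_ (integrable_const _) ?_ ?_
  · intro n
    have := hX.measurable
    refine Measurable.aestronglyMeasurable (Finset.measurable_prod _ fun i _ => ?_)
    exact (hm.comp (this i)).const_sub 1
  · intro n
    exact Eventually.of_forall fun ω =>
      abs_prod_one_sub_le_one (fun i => h0 _) (fun i => h1 _)
  · filter_upwards [hX.ae_finite hlam hA hA'] with ω hω
    obtain ⟨N, hN⟩ := hω.bddAbove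
    refine tendsto_const_nhds.congr' ?_
    filter_upwards [eventually_gt_atTop N] with n hn
    exact finprod_one_sub_eq hsupp fun i hi => Finset.mem_range.2 ((hN hi).trans_lt hn)

/-- Void probabilities of an independently marked Poisson process: `G` is the set of forbidden
pairs (point, mark). -/
theorem IsPoissonProcess.measureReal_forall_notMem [IsProbabilityMeasure P]
    (hX : IsPoissonProcess P lam X) (hlam : 0 ≤ lam) {K : Type*} [MeasurableSpace K]
    {M : ℕ → Ω → K} (hM : ∀ i, Measurable (M i)) (hMi : iIndepFun M P)
    (hXM : IndepFun (fun ω i => X i ω) (fun ω i => M i ω) P)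
    {G : Set (Space d × K)} (hG : MeasurableSet G) {A : Set (Space d)} (hA : MeasurableSet A)
    (hA' : volume A < ∞) {h : Space d → ℝ} (hm : Measurable h)
    (hh : ∀ i x, P.real {ω | (x, M i ω) ∈ G} = h x)
    (hsupp : ∀ x ∉ A, h x = 0) :
    P.real {ω | ∀ i, (X i ω, M i ω) ∉ G} = Real.exp (-(lam * ∫ x, h x)) := by
  have h0 (x) : 0 ≤ h x := by rw [← hh 0]; positivity
  have h1 (x) : h x ≤ 1 := by rw [← hh 0]; exact measureReal_le_one
  have hXm : Measurable fun ω i => X i ω := measurable_pi_iff.2 hX.measurable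
  have hMm : Measurable fun ω i => M i ω := measurable_pi_iff.2 hM
  set E : ℕ → Set ((ℕ → Space d) × (ℕ → K)) := fun n =>
    {p | ∀ i ∈ Finset.range n, (p.1 i, p.2 i) ∉ G} with hE
  have hEm (n : ℕ) : MeasurableSet (E n) := by
    have : E n = ⋂ i ∈ Finset.range n,
        (fun p : (ℕ → Space d) × (ℕ → K) => (p.1 i, p.2 i)) ⁻¹' Gᶜ := by
      ext p; simp [hE]
    rw [this]
    refine Finset.measurableSet_biInter _ fun i _ => ?_
    exact (by fun_prop : Measurable fun p : (ℕ → Space d) × (ℕ → K) => (p.1 i, p.2 i)) hG.compl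
  -- With the points frozen at `x`, only the independent marks are random.
  have hfib (n : ℕ) (x : ℕ → Space d) : P.real {ω | (x, fun i => M i ω) ∈ E n} =
      ∏ i ∈ Finset.range n, (1 - h (x i)) := by
    have hGx (i : ℕ) : MeasurableSet {k | (x i, k) ∉ G} := measurable_prodMk_left hG.compl
    have := hMi.measure_inter_preimage_eq_mul (Finset.range n) (sets := fun i => {k | (x i, k) ∉ G})
      (fun i _ => hGx i)
    have hset : {ω | (x, fun i => M i ω) ∈ E n} =
        ⋂ i ∈ Finset.range n, M i ⁻¹' {k | (x i, k) ∉ G} := by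
      ext ω; simp [hE]
    rw [hset, measureReal_def, this, ENNReal.toReal_prod]
    refine Finset.prod_congr rfl fun i _ => ?_
    rw [← hh i, ← probReal_compl_eq_one_sub]
    · rfl
    · exact hM i (measurable_prodMk_left hG)
  have hcount (n : ℕ) : P.real {ω | ∀ i ∈ Finset.range n, (X i ω, M i ω) ∉ G} =
      ∫ ω, ∏ i ∈ Finset.range n, (1 - h (X i ω)) ∂P := by
    -- Points and marks have a product joint law, so the frozen-point formula can be averaged over
    -- the points by Fubini.
    have hprod := (indepFun_iff_map_prod_eq_prod_map_map hXm.aemeasurable hMm.aemeasurable).1 hXM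
    have : P {ω | ∀ i ∈ Finset.range n, (X i ω, M i ω) ∉ G} =
        (P.map fun ω => ((fun i => X i ω), fun i => M i ω)) (E n) := by
      rw [Measure.map_apply (hXm.prodMk hMm) (hEm n)]
      rfl
    rw [measureReal_def, this, hprod, Measure.prod_apply (hEm n),
      lintegral_map (measurable_measure_prodMk_left (hEm n)) hXm,
      ← integral_toReal]
    · refine integral_congr_ae (Eventually.of_forall fun ω => ?_)
      simp only
      rw [Measure.map_apply hMm (measurable_prodMk_left (hEm n)), ← hfib n]
      rfl
    · exact ((measurable_measure_prodMk_left (hEm n)).comp hXm).aemeasurable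
    · have := Measure.isProbabilityMeasure_map (μ := P) hMm.aemeasurable
      exact Eventually.of_forall fun ω => measure_lt_top _ _
  have hlim := hX.tendsto_integral_prod_one_sub hlam hA hA' hm h0 h1 hsupp
  simp_rw [← hcount] at hlim
  refine tendsto_nhds_unique ?_ hlim
  have hset : {ω | ∀ i, (X i ω, M i ω) ∉ G} =
      ⋂ n, {ω | ∀ i ∈ Finset.range n, (X i ω, M i ω) ∉ G} := by
    ext ω
    simp only [mem_ofPred_eq, mem_iInter, Finset.mem_range]
    exact ⟨fun hω n i _ => hω i, fun hω i => hω (i + 1) i (Nat.lt_succ_self i)⟩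
  rw [hset]
  refine (ENNReal.tendsto_toReal (measure_ne_top _ _)).comp
    (tendsto_measure_iInter_atTop ?_ ?_ ⟨0, measure_ne_top _ _⟩)
  · intro n
    exact ((hXm.prodMk hMm) (hEm n)).nullMeasurableSet
  · intro n m hnm ω hω i hi
    exact hω i (Finset.mem_range.2 ((Finset.mem_range.1 hi).trans_le hnm))

end PoissonFunctional

/-! ### Stationary law of the on-off chain -/

section OnOff

/-- The columns of the matrix are eigenvectors of the generator, with eigenvalues `0` and `-(mu0 +
mu1)`. -/
theorem exp_onOffGenerator_mul_eigenvectors {mu0 mu1 : ℝ} (h : 0 < mu0 + mu1) :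
    NormedSpace.exp (onOffGenerator mu0 mu1) * !![1, -mu0; 1, mu1] =
      !![1, -mu0; 1, mu1] * Matrix.diagonal ![1, Real.exp (-(mu0 + mu1))] := by
  set U : Matrix (Fin 2) (Fin 2) ℝ := !![1, -mu0; 1, mu1] with hU
  have hdet : IsUnit U.det := by
    rw [hU, Matrix.det_fin_two_of, isUnit_iff_ne_zero]
    linarith [h]
  have hUu : IsUnit U := (Matrix.isUnit_iff_isUnit_det U).2 hdet
  have hQ : onOffGenerator mu0 mu1 = U * Matrix.diagonal ![0, -(mu0 + mu1)] * U⁻¹ := by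
    have : onOffGenerator mu0 mu1 * U = U * Matrix.diagonal ![0, -(mu0 + mu1)] := by
      ext i j
      fin_cases i <;> fin_cases j <;>
        simp [hU, onOffGenerator, Matrix.mul_apply, Fin.sum_univ_two] <;> ring
    rw [← this, Matrix.mul_nonsing_inv_cancel_right _ _ hdet]
  have hexp : NormedSpace.exp ![0, -(mu0 + mu1)] = ![1, Real.exp (-(mu0 + mu1))] := by
    ext i
    rw [Pi.coe_exp]
    fin_cases i
    · simp
    · simp [Real.exp_eq_exp_ℝ]
  rw [hQ, Matrix.exp_conj _ _ hUu, Matrix.exp_diagonal, hexp,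
    Matrix.nonsing_inv_mul_cancel_right _ _ hdet]

variable {Ω : Type*} [MeasurableSpace Ω] {P : Measure Ω} {mu0 mu1 : ℝ} {Y : ℝ≥0 → Ω → Fin 2}

theorem IsStationaryOnOff.measureReal_eq_one [IsProbabilityMeasure P]
    (hY : IsStationaryOnOff P mu0 mu1 Y) (h : 0 < mu0 + mu1) (t : ℝ≥0) :
    P.real {ω | Y t ω = 1} = mu0 / (mu0 + mu1) := by
  rw [hY.stationary]
  have hmeas (t : ℝ≥0) (j : Fin 2) : MeasurableSet {ω | Y t ω = j} :=
    hY.measurable t (measurableSet_singleton j)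
  set E := NormedSpace.exp (onOffGenerator mu0 mu1) with hE
  have hjoint (i k : Fin 2) :
      P.real {ω | Y 0 ω = i ∧ Y 1 ω = k} = P.real {ω | Y 0 ω = i} * E i k := by
    have hmono : StrictMono (![0, 1] : Fin 2 → ℝ≥0) := by
      rw [Fin.strictMono_iff_lt_succ]
      intro i
      fin_cases i
      simp
    simpa [Fin.forall_fin_two, hE] using hY.markov 1 ![0, 1] hmono ![i, k]
  have hcompl (t : ℝ≥0) : P.real {ω | Y t ω = 0} = 1 - P.real {ω | Y t ω = 1} := by
    rw [← probReal_compl_eq_one_sub (hmeas t 1)]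
    congr 1
    ext ω
    simp only [mem_ofPred_eq, mem_compl_iff]
    lia
  have htot : P.real {ω | Y 1 ω = 1} =
      P.real {ω | Y 0 ω = 0 ∧ Y 1 ω = 1} + P.real {ω | Y 0 ω = 1 ∧ Y 1 ω = 1} := by
    rw [← measureReal_union]
    · congr 1
      ext ω
      simp only [mem_ofPred_eq, mem_union]
      lia
    · rw [Set.disjoint_left]
      rintro ω ⟨h1, -⟩ ⟨h2, -⟩
      simp [h1] at h2
    · exact (hmeas 0 1).inter (hmeas 1 1)
  rw [hjoint, hjoint, hY.stationary 1, hcompl] at htot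
  have hU := exp_onOffGenerator_mul_eigenvectors h
  rw [← hE] at hU
  have hlt : Real.exp (-(mu0 + mu1)) < 1 := by
    rw [← Real.exp_zero]
    exact Real.exp_lt_exp.2 (by linarith)
  generalize Real.exp (-(mu0 + mu1)) = q at hU hlt
  have e00 := congrFun (congrFun hU 0) 0
  have e01 := congrFun (congrFun hU 0) 1
  have e10 := congrFun (congrFun hU 1) 0
  have e11 := congrFun (congrFun hU 1) 1
  simp [Matrix.mul_apply, Fin.sum_univ_two] at e00 e01 e10 e11
  set p := P.real {ω | Y 0 ω = 1}
  rw [eq_div_iff h.ne']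
  -- The eigenvector relations determine column `1` of the transition matrix `E`; inserted into the
  -- balance equation `p = (1 - p) * E 0 1 + p * E 1 1`, they give this identity, and `q < 1` then
  -- determines `p`.
  have h1 : (1 - q) * (p * (mu0 + mu1) - mu0) = 0 := by
    linear_combination (mu0 + mu1) * htot + (1 - p) * e01 + (1 - p) * mu0 * e00 + p * e11 +
      p * mu0 * e10
  have := (mul_eq_zero.1 h1).resolve_left (by linarith)
  linarith

end OnOff

/-! ### Strong law under finite-range correlations -/

section Decorrelated

variable {Ω : Type*} [MeasurableSpace Ω] {P : Measure Ω} {f : ℝ → Ω → ℝ}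

theorem intervalIntegrable_of_abs_le_one (hm : Measurable (Function.uncurry f))
    (hb : ∀ s ω, |f s ω| ≤ 1) (a b : ℝ) (ω : Ω) :
    IntervalIntegrable (fun s => f s ω) volume a b := by
  have h1 : Measurable fun s => f s ω := hm.comp (measurable_id.prodMk measurable_const)
  have (a b : ℝ) : IntegrableOn (fun s => f s ω) (Ioc a b) volume :=
    Measure.integrableOn_of_bounded (M := 1) measure_Ioc_lt_top.ne h1.aestronglyMeasurable
      (Eventually.of_forall fun s => hb s ω)
  exact ⟨this a b, this b a⟩

/-- The variance of the integral of a process whose correlations have range `R`. -/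
theorem integral_sq_integral_le [IsProbabilityMeasure P] (hm : Measurable (Function.uncurry f))
    (hb : ∀ s ω, |f s ω| ≤ 1) {R : ℝ} (hR : 0 ≤ R)
    (hdec : ∀ s t, 0 ≤ s → 0 ≤ t → R < |s - t| → ∫ ω, f s ω * f t ω ∂P = 0) {T : ℝ} (hT : 0 ≤ T) :
    ∫ ω, (∫ s in (0 : ℝ)..T, f s ω) ^ 2 ∂P ≤ 2 * R * T := by
  set m : Measure ℝ := volume.restrict (Ioc 0 T) with hmdef
  have hfin : IsFiniteMeasure m := ⟨by simp [hmdef]⟩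
  have hsq (ω : Ω) : (∫ s in (0 : ℝ)..T, f s ω) ^ 2 = ∫ p, f p.1 ω * f p.2 ω ∂(m.prod m) := by
    rw [integral_prod_mul (fun s => f s ω) (fun s => f s ω), intervalIntegral.integral_of_le hT, sq]
  simp_rw [hsq]
  have hmeas : Measurable fun q : Ω × (ℝ × ℝ) => f q.2.1 q.1 * f q.2.2 q.1 := by
    refine Measurable.mul ?_ ?_
    · exact hm.comp (g := Function.uncurry f) (f := fun q : Ω × (ℝ × ℝ) => (q.2.1, q.1))
        (by fun_prop)
    · exact hm.comp (g := Function.uncurry f) (f := fun q : Ω × (ℝ × ℝ) => (q.2.2, q.1))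
        (by fun_prop)
  have hbound (s t ω) : ‖f s ω * f t ω‖ ≤ 1 := by
    rw [norm_mul]
    exact mul_le_one₀ (hb s ω) (norm_nonneg _) (hb t ω)
  rw [integral_integral_swap]
  swap
  · exact Integrable.of_bound hmeas.aestronglyMeasurable 1
      (Eventually.of_forall fun q => hbound _ _ _)
  -- Off this diagonal band the correlation vanishes, and on it the correlation is at most one. Each
  -- slice of the band has length at most `2 * R`.
  set S : Set (ℝ × ℝ) := {p | |p.1 - p.2| ≤ R} with hS
  have hSm : MeasurableSet S := by
    apply measurableSet_le <;> fun_prop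
  calc ∫ p, ∫ ω, f p.1 ω * f p.2 ω ∂P ∂(m.prod m)
      ≤ ∫ p, S.indicator (fun _ => (1 : ℝ)) p ∂(m.prod m) := by
        refine integral_mono_ae ?_ ?_ ?_
        · refine Integrable.of_bound ?_ 1 ?_
          · exact (StronglyMeasurable.integral_prod_left'
              hmeas.stronglyMeasurable).aestronglyMeasurable
          · refine Eventually.of_forall fun p => ?_
            refine (norm_integral_le_of_norm_le_const
              (Eventually.of_forall fun ω => hbound p.1 p.2 ω)).trans ?_
            simp
        · exact (integrable_const _).indicator hSm
        · have hae : ∀ᵐ p ∂(m.prod m), p ∈ Ioc 0 T ×ˢ Ioc 0 T := by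
            rw [hmdef, Measure.prod_restrict]
            exact ae_restrict_mem (measurableSet_Ioc.prod measurableSet_Ioc)
          filter_upwards [hae] with p hp
          by_cases hpS : p ∈ S
          · rw [indicator_of_mem hpS]
            refine (Real.le_norm_self _).trans ((norm_integral_le_of_norm_le_const
              (Eventually.of_forall fun ω => hbound p.1 p.2 ω)).trans ?_)
            simp
          · rw [indicator_of_notMem hpS]
            exact (hdec _ _ hp.1.1.le hp.2.1.le (not_le.1 hpS)).le
    _ = ∫ s, ∫ t, S.indicator (fun _ => (1 : ℝ)) (s, t) ∂m ∂m :=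
        integral_prod _ ((integrable_const _).indicator hSm)
    _ ≤ ∫ s, 2 * R ∂m := by
        refine integral_mono_ae ?_ (integrable_const _) (Eventually.of_forall fun s => ?_)
        · exact ((integrable_const _).indicator hSm).integral_prod_left
        · have hset : (fun t => S.indicator (fun _ => (1 : ℝ)) (s, t)) =
              (Icc (s - R) (s + R)).indicator fun _ => 1 := by
            ext t
            have : (s, t) ∈ S ↔ t ∈ Icc (s - R) (s + R) := by
              simp only [hS, mem_ofPred_eq, abs_le, mem_Icc]
              constructor <;> rintro ⟨h1, h2⟩ <;> constructor <;> linarith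
            by_cases ht : (s, t) ∈ S
            · rw [indicator_of_mem ht, indicator_of_mem (this.1 ht)]
            · rw [indicator_of_notMem ht, indicator_of_notMem (fun h => ht (this.2 h))]
          simp only [hset]
          rw [integral_indicator_const _ measurableSet_Icc, smul_eq_mul, mul_one]
          calc m.real (Icc (s - R) (s + R)) ≤ volume.real (Icc (s - R) (s + R)) :=
                ENNReal.toReal_mono measure_Icc_lt_top.ne (Measure.restrict_apply_le _ _)
            _ = 2 * R := by
                rw [Real.volume_real_Icc_of_le (by linarith)]; ring
    _ = 2 * R * T := by
        rw [integral_const, smul_eq_mul, hmdef, measureReal_restrict_apply_univ,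
          Real.volume_real_Ioc_of_le hT]
        ring

/-- Along squares, the second moments of the averages are at most `2 * R / (n + 1) ^ 2`. The sum of
the squared averages thus has finite expectation and is almost surely finite, so its terms tend to
zero. -/
theorem ae_tendsto_integral_sq_div [IsProbabilityMeasure P]
    (hm : Measurable (Function.uncurry f))
    (hb : ∀ s ω, |f s ω| ≤ 1) {R : ℝ} (hR : 0 ≤ R)
    (hdec : ∀ s t, 0 ≤ s → 0 ≤ t → R < |s - t| → ∫ ω, f s ω * f t ω ∂P = 0) :
    ∀ᵐ ω ∂P, Tendsto (fun n : ℕ => (∫ s in (0 : ℝ)..((n : ℝ) + 1) ^ 2, f s ω) / ((n : ℝ) + 1) ^ 2)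
      atTop (𝓝 0) := by
  set W : ℕ → Ω → ℝ := fun n ω => (∫ s in (0 : ℝ)..((n : ℝ) + 1) ^ 2, f s ω) / ((n : ℝ) + 1) ^ 2
    with hW
  have hWm (n : ℕ) : Measurable (W n) := by
    refine Measurable.div_const ?_ _
    simp_rw [intervalIntegral.integral_of_le (show (0 : ℝ) ≤ ((n : ℝ) + 1) ^ 2 by positivity)]
    exact (StronglyMeasurable.integral_prod_left'
      (f := Function.uncurry f) hm.stronglyMeasurable).measurable
  have hW1 (n : ℕ) (ω : Ω) : |W n ω| ≤ 1 := by
    have := intervalIntegral.norm_integral_le_of_norm_le_const (f := fun s => f s ω) (a := 0)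
      (b := ((n : ℝ) + 1) ^ 2) (C := 1) (fun s _ => hb s ω)
    rw [sub_zero, one_mul, abs_of_nonneg (by positivity), Real.norm_eq_abs] at this
    simp only [hW]
    rw [abs_div, abs_of_nonneg (show (0 : ℝ) ≤ ((n : ℝ) + 1) ^ 2 by positivity)]
    exact div_le_one_of_le₀ this (by positivity)
  have hWint (n : ℕ) : ∫ ω, (W n ω) ^ 2 ∂P ≤ 2 * R * (1 / ((n : ℝ) + 1) ^ 2) := by
    have := integral_sq_integral_le hm hb hR hdec (T := ((n : ℝ) + 1) ^ 2) (by positivity)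
    simp only [hW, div_pow]
    rw [integral_div, div_le_iff₀ (by positivity)]
    refine this.trans_eq ?_
    field_simp
  have hsum : ∑' n, ∫⁻ ω, ENNReal.ofReal ((W n ω) ^ 2) ∂P ≠ ∞ := by
    have hs : Summable fun n : ℕ => 2 * R * (1 / ((n : ℝ) + 1) ^ 2) := by
      have := (summable_nat_add_iff 1).2 (Real.summable_one_div_nat_pow.2 (one_lt_two))
      exact Summable.mul_left _ (by simpa using this)
    refine ne_top_of_le_ne_top hs.tsum_ofReal_ne_top (ENNReal.tsum_le_tsum fun n => ?_)
    rw [← ofReal_integral_eq_lintegral_ofReal]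
    · exact ENNReal.ofReal_le_ofReal (hWint n)
    · refine Integrable.of_bound ((hWm n).pow_const 2).aestronglyMeasurable 1
        (Eventually.of_forall fun ω => ?_)
      rw [norm_pow]
      exact pow_le_one₀ (norm_nonneg _) (hW1 n ω)
    · exact Eventually.of_forall fun ω => sq_nonneg _
  rw [← lintegral_tsum fun n => ((hWm n).pow_const 2).ennreal_ofReal.aemeasurable] at hsum
  filter_upwards [ae_lt_top (by fun_prop) hsum] with ω hω
  have h1 := ENNReal.tendsto_atTop_zero_of_tsum_ne_top hω.ne
  have h2 : Tendsto (fun n => (W n ω) ^ 2) atTop (𝓝 0) := by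
    have := (ENNReal.tendsto_toReal ENNReal.zero_ne_top).comp h1
    simpa [Function.comp_def, ENNReal.toReal_ofReal (sq_nonneg _)] using this
  have h3 := h2.sqrt
  simp only [Real.sqrt_sq_eq_abs, Real.sqrt_zero] at h3
  exact (tendsto_zero_iff_abs_tendsto_zero _).2 h3

/-- Strong law of large numbers for bounded processes with correlations of finite range. -/
theorem ae_tendsto_integral_div [IsProbabilityMeasure P]
    (hm : Measurable (Function.uncurry f))
    (hb : ∀ s ω, |f s ω| ≤ 1) {R : ℝ} (hR : 0 ≤ R)
    (hdec : ∀ s t, 0 ≤ s → 0 ≤ t → R < |s - t| → ∫ ω, f s ω * f t ω ∂P = 0) :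
    ∀ᵐ ω ∂P, Tendsto (fun T : ℝ => (∫ s in (0 : ℝ)..T, f s ω) / T) atTop (𝓝 0) := by
  filter_upwards [ae_tendsto_integral_sq_div hm hb hR hdec] with ω hω
  have hlim : Tendsto (fun n : ℕ => |(∫ s in (0 : ℝ)..((n : ℝ) + 1) ^ 2, f s ω) / ((n : ℝ) + 1) ^ 2|
      + 3 * (1 / ((n : ℝ) + 1))) atTop (𝓝 0) := by
    have := hω.abs.add ((tendsto_one_div_add_atTop_nhds_zero_nat (𝕜 := ℝ)).const_mul 3)
    simpa using this
  -- This index satisfies `(n + 1) ^ 2 ≤ T ≤ (n + 2) ^ 2` once `T ≥ 1`. The integral over the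
  -- remaining piece is at most `2 * n + 3 ≤ 3 * (n + 1)`, negligible against `(n + 1) ^ 2`.
  have hN : Tendsto (fun T : ℝ => ⌊√T⌋₊ - 1) atTop atTop :=
    (tendsto_sub_atTop_nat 1).comp (tendsto_nat_floor_atTop.comp Real.tendsto_sqrt_atTop)
  refine squeeze_zero_norm' ?_ (hlim.comp hN)
  filter_upwards [eventually_ge_atTop 1] with T hT
  have hk : 1 ≤ ⌊√T⌋₊ := Nat.le_floor (by simpa using hT)
  set n := ⌊√T⌋₊ - 1 with hn
  have hn1 : (n : ℝ) + 1 = ⌊√T⌋₊ := by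
    rw [hn]; push_cast [hk]; ring
  have h1 : ((n : ℝ) + 1) ^ 2 ≤ T := by
    rw [hn1, ← Real.le_sqrt (by positivity) (by linarith)]
    exact Nat.floor_le (Real.sqrt_nonneg _)
  have h2 : T ≤ ((n : ℝ) + 2) ^ 2 := by
    have := (Nat.lt_floor_add_one √T).le
    rw [← hn1] at this
    rw [← Real.sqrt_le_left (by positivity)]
    linarith
  have hadd : ∫ s in (0 : ℝ)..T, f s ω =
      (∫ s in (0 : ℝ)..((n : ℝ) + 1) ^ 2, f s ω) + ∫ s in ((n : ℝ) + 1) ^ 2..T, f s ω :=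
    (intervalIntegral.integral_add_adjacent_intervals
      (intervalIntegrable_of_abs_le_one hm hb _ _ _)
      (intervalIntegrable_of_abs_le_one hm hb _ _ _)).symm
  have htail := intervalIntegral.norm_integral_le_of_norm_le_const (f := fun s => f s ω)
    (a := ((n : ℝ) + 1) ^ 2) (b := T) (C := 1) (fun s _ => hb s ω)
  rw [one_mul, abs_of_nonneg (by linarith)] at htail
  have hpos : (0 : ℝ) < ((n : ℝ) + 1) ^ 2 := by positivity
  simp only [Function.comp_apply]
  rw [norm_div, Real.norm_of_nonneg (show 0 ≤ T by linarith), abs_div, abs_of_pos hpos]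
  calc ‖∫ s in (0 : ℝ)..T, f s ω‖ / T
      ≤ ‖∫ s in (0 : ℝ)..T, f s ω‖ / ((n : ℝ) + 1) ^ 2 := by gcongr
    _ ≤ (|∫ s in (0 : ℝ)..((n : ℝ) + 1) ^ 2, f s ω| + 3 * ((n : ℝ) + 1)) / ((n : ℝ) + 1) ^ 2 := by
        gcongr
        rw [hadd]
        refine (norm_add_le _ _).trans (add_le_add le_rfl (htail.trans ?_))
        have : (0 : ℝ) ≤ n := n.cast_nonneg
        linarith [show ((n : ℝ) + 2) ^ 2 - ((n : ℝ) + 1) ^ 2 = 2 * n + 3 by ring]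
    _ = |∫ s in (0 : ℝ)..((n : ℝ) + 1) ^ 2, f s ω| / ((n : ℝ) + 1) ^ 2
        + 3 * (1 / ((n : ℝ) + 1)) := by field_simp

end Decorrelated

/-! ### Independence of paired marks -/

/-- Two independent sequences of independent variables give a sequence of independent pairs. -/
theorem iIndepFun_prodMk {Ω ι α β : Type*} [MeasurableSpace Ω] [MeasurableSpace α]
    [MeasurableSpace β] {P : Measure Ω} {f : ι → Ω → α} {g : ι → Ω → β}
    (hf : ∀ i, Measurable (f i)) (hg : ∀ i, Measurable (g i)) (hfi : iIndepFun f P)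
    (hgi : iIndepFun g P) (hfg : IndepFun (fun ω i => f i ω) (fun ω i => g i ω) P) :
    iIndepFun (fun i ω => (f i ω, g i ω)) P := by
  rw [iIndepFun_iff_iIndep]
  -- Rectangles form a π-system generating the σ-algebra of each pair, so the product formula need
  -- only be checked on them.
  refine iIndepSets.iIndep (fun i => ((hf i).prodMk (hg i)).comap_le)
    (fun i => preimage (fun ω => (f i ω, g i ω)) ''
      image2 (· ×ˢ ·) {s : Set α | MeasurableSet s} {t : Set β | MeasurableSet t}) ?_ ?_ ?_
  · rintro i - ⟨u, hu, rfl⟩ - ⟨v, hv, rfl⟩ hne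
    refine ⟨u ∩ v, isPiSystem_prod u hu v hv ?_, rfl⟩
    obtain ⟨ω, hω⟩ := hne
    exact ⟨_, hω⟩
  · intro i
    rw [← generateFrom_prod, MeasurableSpace.comap_generateFrom]
  · rw [iIndepSets_iff]
    intro S E hE
    have hE' (i : ι) : ∃ (s : Set α) (t : Set β), MeasurableSet s ∧ MeasurableSet t ∧
        (i ∈ S → E i = f i ⁻¹' s ∩ g i ⁻¹' t) := by
      by_cases hi : i ∈ S
      · obtain ⟨-, ⟨s, hs, t, ht, rfl⟩, hst⟩ := hE i hi
        exact ⟨s, t, hs, ht, fun _ => hst.symm⟩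
      · exact ⟨∅, ∅, .empty, .empty, fun h => absurd h hi⟩
    choose s t hs ht hst using hE'
    have hone (i : ι) : P (f i ⁻¹' s i ∩ g i ⁻¹' t i) = P (f i ⁻¹' s i) * P (g i ⁻¹' t i) :=
      (hfg.comp (measurable_pi_apply i) (measurable_pi_apply i)).measure_inter_preimage_eq_mul
        _ _ (hs i) (ht i)
    have hinter : ⋂ i ∈ S, E i =
        (fun ω i => f i ω) ⁻¹' (⋂ i ∈ S, (fun x : ι → α => x i) ⁻¹' s i) ∩
          (fun ω i => g i ω) ⁻¹' (⋂ i ∈ S, (fun x : ι → β => x i) ⁻¹' t i) := by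
      rw [iInter₂_congr hst]
      ext ω
      simp only [mem_iInter, mem_inter_iff, mem_preimage]
      exact ⟨fun h => ⟨fun i hi => (h i hi).1, fun i hi => (h i hi).2⟩,
        fun h i hi => ⟨h.1 i hi, h.2 i hi⟩⟩
    rw [hinter, hfg.measure_inter_preimage_eq_mul _ _
      (Finset.measurableSet_biInter _ fun i _ => measurable_pi_apply i (hs i))
      (Finset.measurableSet_biInter _ fun i _ => measurable_pi_apply i (ht i)),
      Finset.prod_congr rfl fun i hi => (congrArg P (hst i hi)).trans (hone i),
      Finset.prod_mul_distrib, ← hfi.measure_inter_preimage_eq_mul S fun i _ => hs i,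
      ← hgi.measure_inter_preimage_eq_mul S fun i _ => ht i]
    simp only [preimage_iInter]
    rfl

/-! ### Random closed sets and their coverage function -/

section Shapes

variable {d : ℕ}

/-- Membership is jointly measurable in the point and the closed set. -/
theorem measurableSet_mem_closeds :
    MeasurableSet {p : Space d × Closeds (Space d) | p.1 ∈ (p.2 : Set (Space d))} := by
  -- As `F` is closed, `x ∈ F` means that at every scale some small ball centred in a countable
  -- dense set contains `x` and hits `F`. Closed balls are compact, so these hitting events are
  -- generators of the σ-algebra.
  have hset : {p : Space d × Closeds (Space d) | p.1 ∈ (p.2 : Set (Space d))} =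
      ⋂ n : ℕ, ⋃ k : ℕ,
        (Metric.closedBall (denseSeq (Space d) k) (1 / ((n : ℝ) + 1))) ×ˢ
          {F : Closeds (Space d) | ((F : Set (Space d)) ∩
            Metric.closedBall (denseSeq (Space d) k) (1 / ((n : ℝ) + 1))).Nonempty} := by
    ext ⟨x, F⟩
    simp only [mem_ofPred_eq, mem_iInter, mem_iUnion, mem_prod]
    constructor
    · intro hx n
      obtain ⟨k, hk⟩ := (denseRange_denseSeq (Space d)).exists_dist_lt x
        (show (0 : ℝ) < 1 / ((n : ℝ) + 1) by positivity)
      exact ⟨k, hk.le, x, hx, hk.le⟩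
    · intro h
      refine F.isClosed.closure_subset (Metric.mem_closure_iff.2 fun ε hε => ?_)
      obtain ⟨n, hn⟩ := exists_nat_one_div_lt (half_pos hε)
      obtain ⟨k, hk, y, hyF, hy⟩ := h n
      refine ⟨y, hyF, ?_⟩
      have h1 : dist x (denseSeq (Space d) k) ≤ 1 / ((n : ℝ) + 1) := hk
      have h2 : dist y (denseSeq (Space d) k) ≤ 1 / ((n : ℝ) + 1) := hy
      linarith [dist_triangle_right x y (denseSeq (Space d) k)]
  rw [hset]
  refine MeasurableSet.iInter fun n => MeasurableSet.iUnion fun k => ?_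
  exact Metric.isClosed_closedBall.measurableSet.prod
    (MeasurableSpace.measurableSet_generateFrom ⟨_, isCompact_closedBall _ _, rfl⟩)

/-- The probability that a random set with law `nu` contains the point `x`. -/
noncomputable def coverProb (nu : Measure (Closeds (Space d))) (x : Space d) : ℝ :=
  nu.real {F | x ∈ (F : Set (Space d))}

variable {nu : Measure (Closeds (Space d))} {tau : ℝ}

theorem measurable_coverProb [IsProbabilityMeasure nu] : Measurable (coverProb nu) :=
  (measurable_measure_prodMk_left measurableSet_mem_closeds).ennreal_toReal

theorem coverProb_eq_zero
    (hball : ∀ᵐ F : Closeds (Space d) ∂nu, (F : Set (Space d)) ⊆ Metric.closedBall 0 tau)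
    {x : Space d} (hx : tau < ‖x‖) : coverProb nu x = 0 := by
  rw [coverProb, measureReal_def, measure_eq_zero_iff_ae_notMem.2 ?_, ENNReal.toReal_zero]
  filter_upwards [hball] with F hF hxF
  have : x ∈ Metric.closedBall (0 : Space d) tau := hF hxF
  rw [mem_closedBall_zero_iff] at this
  exact absurd this (not_le.2 hx)

/-- Both sides are the mass, under the product of `volume` and `nu`, of the set of pairs with `x ∈
F`. -/
theorem integral_coverProb [IsProbabilityMeasure nu]
    (hball : ∀ᵐ F : Closeds (Space d) ∂nu, (F : Set (Space d)) ⊆ Metric.closedBall 0 tau) :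
    ∫ x, coverProb nu x = ∫ F : Closeds (Space d), volume.real (F : Set (Space d)) ∂nu := by
  have hS := measurableSet_mem_closeds (d := d)
  have hm1 : Measurable fun x : Space d => nu {F | x ∈ (F : Set (Space d))} :=
    measurable_measure_prodMk_left hS
  have hm2 : Measurable fun F : Closeds (Space d) => volume (F : Set (Space d)) :=
    measurable_measure_prodMk_right hS
  simp only [coverProb, measureReal_def]
  rw [integral_toReal hm1.aemeasurable (Eventually.of_forall fun x => measure_lt_top _ _),
    integral_toReal hm2.aemeasurable]
  · congr 1
    exact (Measure.prod_apply (μ := volume) (ν := nu) hS).symm.trans (Measure.prod_apply_symm hS)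
  · filter_upwards [hball] with F hF
    exact (measure_mono hF).trans_lt measure_closedBall_lt_top

end Shapes

/-! ### Vacancy probabilities at one and two points -/

/-- The event that at time `s` no active set `X i + C i` contains the point `p`. -/
def vacantEvent {Ω : Type*} {d : ℕ} (X : ℕ → Ω → Space d) (C : ℕ → Ω → Closeds (Space d))
    (Y : ℕ → ℝ≥0 → Ω → Fin 2) (s : ℝ≥0) (p : Space d) : Set Ω :=
  {ω | ∀ i, ¬(Y i s ω = 1 ∧ p - X i ω ∈ (C i ω : Set (Space d)))}

theorem one_sub_coverIndicator {Ω : Type*} {d : ℕ} {X : ℕ → Ω → Space d}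
    {C : ℕ → Ω → Closeds (Space d)} {Y : ℕ → ℝ≥0 → Ω → Fin 2} {a u : Space d} {c : ℝ}
    (s : ℝ≥0) (ω : Ω) :
    1 - coverIndicator X C Y a u c s ω =
      (vacantEvent X C Y s (targetPos a u c s)).indicator 1 ω := by
  classical
  have hiff : (∃ i, Y i s ω = 1 ∧ targetPos a u c s ∈ X i ω +ᵥ (C i ω : Set (Space d))) ↔
      ω ∉ vacantEvent X C Y s (targetPos a u c s) := by
    simp [vacantEvent, mem_vadd_set_iff_neg_vadd_mem, sub_eq_neg_add]
  rw [coverIndicator]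
  by_cases h : ω ∈ vacantEvent X C Y s (targetPos a u c s)
  · rw [if_neg (fun h' => hiff.1 h' h), indicator_of_mem h, sub_zero, Pi.one_apply]
  · rw [if_pos (hiff.2 h), indicator_of_notMem h, sub_self]

section Vacancy

variable {Ω : Type*} [MeasurableSpace Ω] {P : Measure Ω} {d : ℕ} {lam mu0 mu1 c tau : ℝ}
  {nu : Measure (Closeds (Space d))} {X : ℕ → Ω → Space d} {C : ℕ → Ω → Closeds (Space d)}
  {Y : ℕ → ℝ≥0 → Ω → Fin 2} {a u : Space d}

theorem measurableSet_vacantEvent (hX : ∀ i, Measurable (X i)) (hC : ∀ i, Measurable (C i))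
    (hY : ∀ i t, Measurable (Y i t)) (s : ℝ≥0) (p : Space d) :
    MeasurableSet (vacantEvent X C Y s p) := by
  have : vacantEvent X C Y s p = ⋂ i, (Y i s ⁻¹' {1} ∩
      (fun ω => (p - X i ω, C i ω)) ⁻¹' {q | q.1 ∈ (q.2 : Set (Space d))})ᶜ := by
    ext ω
    simp [vacantEvent]
  rw [this]
  exact MeasurableSet.iInter fun i => ((hY i s (measurableSet_singleton 1)).inter
    (((hX i).const_sub p).prodMk (hC i) measurableSet_mem_closeds)).compl

theorem IsMPB.isProbabilityMeasure [IsProbabilityMeasure P]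
    (h : IsMPB P lam nu mu0 mu1 X C Y) : IsProbabilityMeasure nu := by
  rw [← h.shape_law 0]
  exact Measure.isProbabilityMeasure_map (h.shape_measurable 0).aemeasurable

theorem IsMPB.measureReal_active_mem [IsProbabilityMeasure P]
    (h : IsMPB P lam nu mu0 mu1 X C Y) (hmu : 0 < mu0 + mu1) (i : ℕ) (s : ℝ≥0) (x : Space d) :
    P.real {ω | Y i s ω = 1 ∧ x ∈ (C i ω : Set (Space d))} =
      mu0 / (mu0 + mu1) * coverProb nu x := by
  have hxm : MeasurableSet {F : Closeds (Space d) | x ∈ (F : Set (Space d))} :=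
    measurable_prodMk_left (x := x) measurableSet_mem_closeds
  have hind : IndepFun (C i) (Y i s) P :=
    h.shape_onOff_indep.comp (measurable_pi_apply i)
      (show Measurable fun y : ℕ → ℝ≥0 → Fin 2 => y i s by fun_prop)
  have := hind.measure_inter_preimage_eq_mul _ _ hxm (measurableSet_singleton 1)
  rw [show {ω | Y i s ω = 1 ∧ x ∈ (C i ω : Set (Space d))} =
      C i ⁻¹' {F : Closeds (Space d) | x ∈ (F : Set (Space d))} ∩ Y i s ⁻¹' {1} from
    Set.ext fun ω => and_comm, measureReal_def, this, ENNReal.toReal_mul, mul_comm, coverProb,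
    ← h.shape_law i, ← (h.onOff i).measureReal_eq_one hmu s, measureReal_def, measureReal_def,
    Measure.map_apply (h.shape_measurable i) hxm]
  rfl

/-- The probability that two points are both vacant, as a void probability of the marked process. -/
theorem IsMPB.measureReal_vacantEvent_inter_eq_exp [IsProbabilityMeasure P]
    (h : IsMPB P lam nu mu0 mu1 X C Y) (hlam : 0 ≤ lam)
    (s t : ℝ≥0) (p q : Space d) {A : Set (Space d)} (hA : MeasurableSet A)
    (hA' : volume A < ∞) {k : Space d → ℝ} (hm : Measurable k)
    (hk : ∀ i x, P.real {ω | (Y i s ω = 1 ∧ p - x ∈ (C i ω : Set (Space d))) ∨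
      (Y i t ω = 1 ∧ q - x ∈ (C i ω : Set (Space d)))} = k x)
    (hsupp : ∀ x ∉ A, k x = 0) :
    P.real (vacantEvent X C Y s p ∩ vacantEvent X C Y t q) = Real.exp (-(lam * ∫ x, k x)) := by
  -- Only the states at the two times matter, so the mark of a point is its shape with these two
  -- states.
  set φ : (ℝ≥0 → Fin 2) → Fin 2 × Fin 2 := fun y => (y s, y t) with hφ
  have hφm : Measurable φ := by fun_prop
  have hYm (i : ℕ) : Measurable fun ω => φ fun t => Y i t ω :=
    hφm.comp (measurable_pi_iff.2 (h.onOff i).measurable)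
  set M : ℕ → Ω → Closeds (Space d) × (Fin 2 × Fin 2) := fun i ω => (C i ω, φ fun t => Y i t ω)
    with hM
  have hMi : iIndepFun M P := by
    refine iIndepFun_prodMk h.shape_measurable hYm h.shape_indep
      (h.onOff_indep.comp (fun _ => φ) fun _ => hφm) ?_
    exact h.shape_onOff_indep.comp measurable_id
      (show Measurable fun (y : ℕ → ℝ≥0 → Fin 2) i => φ (y i) by fun_prop)
  have hXM : IndepFun (fun ω i => X i ω) (fun ω i => M i ω) P :=
    h.point_mark_indep.comp measurable_id
      (show Measurable fun (y : (ℕ → Closeds (Space d)) × (ℕ → ℝ≥0 → Fin 2)) i =>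
        (y.1 i, φ (y.2 i)) by fun_prop)
  have hmem (r : Space d) : MeasurableSet
      {z : Space d × Closeds (Space d) × (Fin 2 × Fin 2) | r - z.1 ∈ (z.2.1 : Set (Space d))} :=
    (show Measurable fun z : Space d × Closeds (Space d) × (Fin 2 × Fin 2) => (r - z.1, z.2.1) by
      fun_prop) measurableSet_mem_closeds
  have hG : MeasurableSet {z : Space d × Closeds (Space d) × (Fin 2 × Fin 2) |
      (z.2.2.1 = 1 ∧ p - z.1 ∈ (z.2.1 : Set (Space d))) ∨
      (z.2.2.2 = 1 ∧ q - z.1 ∈ (z.2.1 : Set (Space d)))} := by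
    refine MeasurableSet.union (MeasurableSet.inter ?_ (hmem p)) (MeasurableSet.inter ?_ (hmem q))
    · exact (show Measurable fun z : Space d × Closeds (Space d) × (Fin 2 × Fin 2) => z.2.2.1 by
        fun_prop) (measurableSet_singleton 1)
    · exact (show Measurable fun z : Space d × Closeds (Space d) × (Fin 2 × Fin 2) => z.2.2.2 by
        fun_prop) (measurableSet_singleton 1)
  rw [← h.poisson.measureReal_forall_notMem hlam (fun i => (h.shape_measurable i).prodMk (hYm i))
    hMi hXM hG hA hA' hm hk hsupp]
  congr 1
  ext ω
  simp only [vacantEvent, mem_inter_iff, mem_ofPred_eq, not_or, forall_and, hφ]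

/-- The two-point formula with both points and both times equal. -/
theorem IsMPB.measureReal_vacantEvent [IsProbabilityMeasure P]
    (h : IsMPB P lam nu mu0 mu1 X C Y) (hlam : 0 ≤ lam) (hmu : 0 < mu0 + mu1)
    (hball : ∀ᵐ F : Closeds (Space d) ∂nu, (F : Set (Space d)) ⊆ Metric.closedBall 0 tau)
    (s : ℝ≥0) (p : Space d) :
    P.real (vacantEvent X C Y s p) =
      Real.exp (-(mu0 / (mu0 + mu1) * lam *
        ∫ F : Closeds (Space d), volume.real (F : Set (Space d)) ∂nu)) := by
  have := h.isProbabilityMeasure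
  have key := h.measureReal_vacantEvent_inter_eq_exp hlam s s p p
    (A := Metric.closedBall p tau) Metric.isClosed_closedBall.measurableSet
    measure_closedBall_lt_top (k := fun x => mu0 / (mu0 + mu1) * coverProb nu (p - x))
    ((measurable_coverProb.comp (measurable_const.sub measurable_id)).const_mul _)
    (fun i x => by simp_rw [or_self]; exact h.measureReal_active_mem hmu i s _)
    (fun x hx => by
      rw [coverProb_eq_zero hball, mul_zero]
      rw [Metric.mem_closedBall, dist_comm, dist_eq_norm] at hx
      exact not_le.1 hx)
  rw [inter_self] at key
  rw [key, integral_const_mul, integral_sub_left_eq_self, integral_coverProb hball]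
  ring_nf

/-- No point of the process lies within `tau` of both `p` and `q`, so the two covering probabilities
add without overlap; the exponent doubles and the vacancy events are independent. -/
theorem IsMPB.measureReal_vacantEvent_inter [IsProbabilityMeasure P]
    (h : IsMPB P lam nu mu0 mu1 X C Y) (hlam : 0 ≤ lam) (hmu : 0 < mu0 + mu1)
    (hball : ∀ᵐ F : Closeds (Space d) ∂nu, (F : Set (Space d)) ⊆ Metric.closedBall 0 tau)
    (s t : ℝ≥0) {p q : Space d} (hpq : 2 * tau < dist p q) :
    P.real (vacantEvent X C Y s p ∩ vacantEvent X C Y t q) =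
      Real.exp (-(mu0 / (mu0 + mu1) * lam *
        ∫ F : Closeds (Space d), volume.real (F : Set (Space d)) ∂nu)) ^ 2 := by
  have := h.isProbabilityMeasure
  have hz {p x : Space d} (hx : tau < dist p x) : coverProb nu (p - x) = 0 :=
    coverProb_eq_zero hball (by rwa [← dist_eq_norm])
  have hcm (p : Space d) : Measurable fun x => mu0 / (mu0 + mu1) * coverProb nu (p - x) :=
    (measurable_coverProb.comp (measurable_const.sub measurable_id)).const_mul _
  have hint (p : Space d) : Integrable fun x => mu0 / (mu0 + mu1) * coverProb nu (p - x) := by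
    refine Integrable.const_mul (Integrable.comp_sub_left (f := coverProb nu) ?_ p) _
    refine Integrable.mono' (g := (Metric.closedBall 0 tau).indicator fun _ => 1)
      ((integrable_indicator_iff Metric.isClosed_closedBall.measurableSet).2
        (integrableOn_const measure_closedBall_lt_top.ne))
      measurable_coverProb.aestronglyMeasurable (Eventually.of_forall fun x => ?_)
    rw [Real.norm_of_nonneg (show 0 ≤ coverProb nu x from measureReal_nonneg)]
    by_cases hx : x ∈ Metric.closedBall (0 : Space d) tau
    · rw [indicator_of_mem hx]; exact measureReal_le_one
    · rw [indicator_of_notMem hx, coverProb_eq_zero hball]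
      rw [mem_closedBall_zero_iff] at hx
      exact not_le.1 hx
  have key := h.measureReal_vacantEvent_inter_eq_exp hlam s t p q
    (A := Metric.closedBall p tau ∪ Metric.closedBall q tau)
    (Metric.isClosed_closedBall.measurableSet.union Metric.isClosed_closedBall.measurableSet)
    ((measure_union_le _ _).trans_lt
      (ENNReal.add_lt_top.2 ⟨measure_closedBall_lt_top, measure_closedBall_lt_top⟩))
    (k := fun x => mu0 / (mu0 + mu1) * coverProb nu (p - x)
      + mu0 / (mu0 + mu1) * coverProb nu (q - x))
    ((hcm p).add (hcm q))
    (fun i x => by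
      have hor : tau < dist p x ∨ tau < dist q x := by
        by_contra! hle
        linarith [dist_triangle_right p q x]
      have h1 := h.measureReal_active_mem hmu i s (p - x)
      have h2 := h.measureReal_active_mem hmu i t (q - x)
      rw [← h1, ← h2]
      refine le_antisymm (measureReal_union_le _ _) ?_
      -- The covering event for the farther point is null, so the union bound is an equality.
      rcases hor with hor | hor
      · rw [h1, hz hor, mul_zero, zero_add]
        exact measureReal_mono fun ω hω => Or.inr hω
      · rw [h2, hz hor, mul_zero, add_zero]
        exact measureReal_mono fun ω hω => Or.inl hω)
    (fun x hx => by
      rw [mem_union, not_or, Metric.mem_closedBall, Metric.mem_closedBall, dist_comm,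
        dist_comm x q] at hx
      rw [hz (not_le.1 hx.1), hz (not_le.1 hx.2), mul_zero, add_zero])
  rw [key, integral_add (hint p) (hint q), integral_const_mul, integral_const_mul,
    integral_sub_left_eq_self, integral_sub_left_eq_self, integral_coverProb hball,
    ← Real.exp_nat_mul]
  congr 1
  push_cast
  ring

end Vacancy

/-! ### Joint measurability in time and outcome -/

/-- The `+ 1` keeps the grid approximations on the right of `x`, as right-continuity requires. -/
theorem tendsto_floor_mul_add_one_div (x : ℝ≥0) :
    Tendsto (fun n : ℕ => ((⌊x * (n + 1)⌋₊ + 1 : ℕ) : ℝ≥0) / (n + 1)) atTop (𝓝[≥] x) := by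
  have hlow (n : ℕ) : x ≤ ((⌊x * (n + 1)⌋₊ + 1 : ℕ) : ℝ≥0) / (n + 1) := by
    rw [le_div_iff₀ (by positivity)]
    push_cast
    exact (Nat.lt_floor_add_one _).le
  have hup (n : ℕ) : ((⌊x * (n + 1)⌋₊ + 1 : ℕ) : ℝ≥0) / (n + 1) ≤ x + 1 / (n + 1) := by
    rw [div_le_iff₀ (by positivity), add_mul, one_div, inv_mul_cancel₀ (by positivity)]
    push_cast
    gcongr
    exact Nat.floor_le (by positivity)
  rw [tendsto_nhdsWithin_iff]
  refine ⟨tendsto_of_tendsto_of_tendsto_of_le_of_le tendsto_const_nhds ?_ hlow hup,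
    Eventually.of_forall hlow⟩
  simpa using (tendsto_one_div_add_atTop_nhds_zero_nat (𝕜 := ℝ≥0)).const_add x

/-- A right-continuous on-off process is indistinguishable from a jointly measurable one. -/
theorem exists_measurableSet_iff_eq_one {Ω : Type*} [MeasurableSpace Ω] {Y : ℝ≥0 → Ω → Fin 2}
    (hY : ∀ t, Measurable (Y t)) :
    ∃ J : Set (ℝ≥0 × Ω), MeasurableSet J ∧
      ∀ ω, (∀ t, ContinuousWithinAt (fun s => Y s ω) (Ici t) t) →
        ∀ t, (t, ω) ∈ J ↔ Y t ω = 1 := by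
  set r : ℕ → ℝ≥0 → ℝ≥0 := fun n t => ((⌊t * (n + 1)⌋₊ + 1 : ℕ) : ℝ≥0) / (n + 1) with hr
  -- The set is the event that `Y (r n t) = 1` for all large `n`. Each `r n` has countable range,
  -- which makes it measurable; since `Fin 2` is discrete, right-continuity makes `Y (r n t)`
  -- eventually equal to `Y t`.
  refine ⟨⋃ N : ℕ, ⋂ n ≥ N, {p | Y (r n p.1) p.2 = 1}, ?_, fun ω hω t => ?_⟩
  · refine MeasurableSet.iUnion fun N => MeasurableSet.iInter fun n =>
      MeasurableSet.iInter fun _ => ?_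
    have h1 : Measurable fun q : Ω × ℕ => Y (((q.2 + 1 : ℕ) : ℝ≥0) / (n + 1)) q.1 :=
      measurable_from_prod_countable_left fun k => hY (((k + 1 : ℕ) : ℝ≥0) / (n + 1))
    have h2 : Measurable fun p : ℝ≥0 × Ω => (p.2, ⌊p.1 * (n + 1)⌋₊) := by fun_prop
    exact (h1.comp h2) (measurableSet_singleton 1)
  · have hlim : ∀ᶠ n in atTop, Y (r n t) ω = Y t ω := by
      have := (hω t).tendsto.comp (tendsto_floor_mul_add_one_div t)
      rw [nhds_discrete, tendsto_pure] at this
      exact this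
    simp only [mem_iUnion, mem_iInter, mem_ofPred_eq]
    rw [← eventually_atTop (p := fun n => Y (r n t) ω = 1)]
    constructor
    · intro h
      obtain ⟨n, h1, h2⟩ := (h.and hlim).exists
      rw [← h2, h1]
    · intro h
      filter_upwards [hlim] with n hn
      rw [hn, h]

/-! ### The vacancy process along the path -/

section MainTheorem

variable {Ω : Type*} [MeasurableSpace Ω] {P : Measure Ω} {d : ℕ} {lam mu0 mu1 c tau : ℝ}
  {nu : Measure (Closeds (Space d))} {X : ℕ → Ω → Space d} {C : ℕ → Ω → Closeds (Space d)}
  {Y : ℕ → ℝ≥0 → Ω → Fin 2} {a u : Space d}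

theorem IsMPB.ae_continuousWithinAt (h : IsMPB P lam nu mu0 mu1 X C Y) :
    ∀ᵐ ω ∂P, ∀ i t, ContinuousWithinAt (fun s => Y i s ω) (Ici t) t := by
  rw [ae_all_iff]
  intro i
  filter_upwards [(h.onOff i).cadlag] with ω hω t
  exact (hω t).1

/-- The vacancy indicator along a measurable path has a jointly measurable version. -/
theorem IsMPB.exists_measurableSet_vacant (h : IsMPB P lam nu mu0 mu1 X C Y)
    {p : ℝ≥0 → Space d} (hp : Measurable p) :
    ∃ D : Set (ℝ≥0 × Ω), MeasurableSet D ∧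
      ∀ᵐ ω ∂P, ∀ s, (s, ω) ∈ D ↔ ω ∈ vacantEvent X C Y s (p s) := by
  choose J hJm hJ using fun i => exists_measurableSet_iff_eq_one (h.onOff i).measurable
  refine ⟨⋂ i, (J i ∩ (fun q : ℝ≥0 × Ω => (p q.1 - X i q.2, C i q.2)) ⁻¹'
    {z | z.1 ∈ (z.2 : Set (Space d))})ᶜ, ?_, ?_⟩
  · refine MeasurableSet.iInter fun i => ((hJm i).inter ?_).compl
    have hX := h.poisson.measurable i
    have hC := h.shape_measurable i
    exact (show Measurable fun q : ℝ≥0 × Ω => (p q.1 - X i q.2, C i q.2) by fun_prop)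
      measurableSet_mem_closeds
  · filter_upwards [h.ae_continuousWithinAt] with ω hω s
    simp [vacantEvent, fun i => hJ i ω (hω i) s]

theorem integral_indicator_sub_mul_indicator_sub [IsProbabilityMeasure P] {A B : Set Ω}
    (hA : MeasurableSet A) (hB : MeasurableSet B) {q : ℝ} (hPA : P.real A = q)
    (hPB : P.real B = q) (hAB : P.real (A ∩ B) = q ^ 2) :
    ∫ ω, (A.indicator 1 ω - q) * (B.indicator 1 ω - q) ∂P = 0 := by
  have hi {S : Set Ω} (hS : MeasurableSet S) : Integrable (S.indicator (1 : Ω → ℝ)) P :=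
    (integrable_const 1).indicator hS
  have heq : (fun ω => (A.indicator 1 ω - q) * (B.indicator 1 ω - q)) = fun ω =>
      (A ∩ B).indicator 1 ω - q * A.indicator 1 ω - (q * B.indicator 1 ω - q ^ 2) := by
    ext ω
    rw [inter_indicator_one, Pi.mul_apply]
    ring
  have h1 : Integrable (fun ω => (A ∩ B).indicator (1 : Ω → ℝ) ω) P := hi (hA.inter hB)
  have h2 : Integrable (fun ω => q * A.indicator (1 : Ω → ℝ) ω) P := (hi hA).const_mul q
  have h3 : Integrable (fun ω => q * B.indicator (1 : Ω → ℝ) ω) P := (hi hB).const_mul q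
  have h4 : Integrable (fun ω => (A ∩ B).indicator (1 : Ω → ℝ) ω - q * A.indicator 1 ω) P :=
    h1.sub h2
  have h5 : Integrable (fun ω => q * B.indicator (1 : Ω → ℝ) ω - q ^ 2) P :=
    h3.sub (integrable_const _)
  rw [heq, integral_sub h4 h5, integral_sub h1 h2,
    integral_sub h3 (integrable_const _), integral_const_mul,
    integral_const_mul, integral_indicator_one (hA.inter hB), integral_indicator_one hA,
    integral_indicator_one hB, hPA, hPB, hAB]
  simp
  ring

theorem dist_targetPos (hu : ‖u‖ = 1) (hc : 0 ≤ c) (s t : ℝ≥0) :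
    dist (targetPos a u c s) (targetPos a u c t) = c * |(s : ℝ) - t| := by
  rw [targetPos, targetPos, dist_add_left, dist_eq_norm, ← sub_smul, norm_smul, hu, mul_one,
    ← mul_sub, Real.norm_eq_abs, abs_mul, abs_of_nonneg hc]

theorem IsMPB.ae_tendsto_vacancyTime_div [IsProbabilityMeasure P]
    (h : IsMPB P lam nu mu0 mu1 X C Y) (hlam : 0 ≤ lam) (htau : 0 ≤ tau)
    (hmu : 0 < mu0 + mu1) (hc : 0 < c) (hu : ‖u‖ = 1)
    (hball : ∀ᵐ F : Closeds (Space d) ∂nu, (F : Set (Space d)) ⊆ Metric.closedBall 0 tau) :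
    ∀ᵐ ω ∂P, Tendsto (fun T : ℝ => vacancyTime X C Y a u c T ω / T) atTop
      (𝓝 (Real.exp (-(mu0 / (mu0 + mu1) * lam *
        ∫ F : Closeds (Space d), volume.real (F : Set (Space d)) ∂nu)))) := by
  have hvac := fun s p => h.measureReal_vacantEvent hlam hmu hball s p
  have hvac2 := fun s t p q hpq =>
    h.measureReal_vacantEvent_inter hlam hmu hball s t (p := p) (q := q) hpq
  have hq1 : Real.exp (-(mu0 / (mu0 + mu1) * lam *
      ∫ F : Closeds (Space d), volume.real (F : Set (Space d)) ∂nu)) ≤ 1 := by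
    rw [← hvac 0 0]; exact measureReal_le_one
  have hq0 := (Real.exp_pos (-(mu0 / (mu0 + mu1) * lam *
      ∫ F : Closeds (Space d), volume.real (F : Set (Space d)) ∂nu))).le
  generalize Real.exp (-(mu0 / (mu0 + mu1) * lam *
      ∫ F : Closeds (Space d), volume.real (F : Set (Space d)) ∂nu)) = q at hvac hvac2 hq0 hq1 ⊢
  have hpm : Measurable (targetPos a u c) := by
    unfold targetPos; fun_prop
  obtain ⟨D, hDm, hD⟩ := h.exists_measurableSet_vacant hpm
  set V : ℝ≥0 → Set Ω := fun s => vacantEvent X C Y s (targetPos a u c s) with hV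
  have hVm (s : ℝ≥0) : MeasurableSet (V s) := measurableSet_vacantEvent h.poisson.measurable
    h.shape_measurable (fun i => (h.onOff i).measurable) _ _
  -- The centred vacancy indicator is built from the jointly measurable `D`; almost surely it agrees
  -- with the true one at all times simultaneously, so the time integrals agree too.
  set f : ℝ → Ω → ℝ := fun s ω => D.indicator 1 (s.toNNReal, ω) - q with hf
  have hfV : ∀ᵐ ω ∂P, ∀ s : ℝ, f s ω = (V s.toNNReal).indicator 1 ω - q := by
    filter_upwards [hD] with ω hω s
    simp only [hf]
    by_cases hs : ω ∈ V s.toNNReal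
    · rw [indicator_of_mem hs, indicator_of_mem ((hω _).2 hs)]; rfl
    · rw [indicator_of_notMem hs, indicator_of_notMem fun h' => hs ((hω _).1 h')]
  have hfm : Measurable (Function.uncurry f) := by
    have h1 : Measurable fun x : ℝ × Ω => (x.1.toNNReal, x.2) := by fun_prop
    exact ((measurable_one.indicator hDm).comp h1).sub_const q
  have hfb (s ω) : |f s ω| ≤ 1 := by
    simp only [hf]
    by_cases hs : (s.toNNReal, ω) ∈ D
    · rw [indicator_of_mem hs, Pi.one_apply, abs_le]
      constructor <;> linarith
    · rw [indicator_of_notMem hs, abs_le]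
      constructor <;> linarith
  -- The time `2 * tau / c` is what the target needs to travel the distance `2 * tau`.
  have hdec (s t : ℝ) (hs : 0 ≤ s) (ht : 0 ≤ t) (hst : 2 * tau / c < |s - t|) :
      ∫ ω, f s ω * f t ω ∂P = 0 := by
    have hdist : 2 * tau < dist (targetPos a u c s.toNNReal) (targetPos a u c t.toNNReal) := by
      rw [dist_targetPos hu hc.le, Real.coe_toNNReal s hs, Real.coe_toNNReal t ht, mul_comm c]
      exact (div_lt_iff₀ hc).1 hst
    rw [← integral_indicator_sub_mul_indicator_sub (hVm s.toNNReal) (hVm t.toNNReal)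
      (hvac _ _) (hvac _ _) (hvac2 _ _ _ _ hdist)]
    refine integral_congr_ae ?_
    filter_upwards [hfV] with ω hω
    rw [hω, hω]
  filter_upwards [ae_tendsto_integral_div hfm hfb (by positivity) hdec, hfV] with ω hlim hω
  have hlim' := hlim.add_const q
  rw [zero_add] at hlim'
  refine hlim'.congr' ?_
  filter_upwards [eventually_gt_atTop 0] with T hT
  have hval : vacancyTime X C Y a u c T ω = (∫ s in (0 : ℝ)..T, f s ω) + T * q := by
    have : T * q = ∫ _ in (0 : ℝ)..T, q := by simp
    rw [this, ← intervalIntegral.integral_add (intervalIntegrable_of_abs_le_one hfm hfb _ _ _)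
      intervalIntegrable_const, vacancyTime]
    refine intervalIntegral.integral_congr fun s _ => ?_
    rw [hω, sub_add_cancel, one_sub_coverIndicator]
  rw [hval, add_div, mul_div_cancel_left₀ _ hT.ne']

end MainTheorem

theorem theorem8 {Ω : Type*} [MeasurableSpace Ω] (P : Measure Ω) [IsProbabilityMeasure P]
    {d : ℕ} (lam tau mu0 mu1 c : ℝ) (hlam : 0 < lam) (htau : 0 < tau)
    (hmu0 : 0 ≤ mu0) (hmu1 : 0 ≤ mu1) (hmu : 0 < mu0 + mu1) (hc : 0 < c)
    (nu : Measure (Closeds (Space d)))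
    (hnu_ball : ∀ᵐ F : Closeds (Space d) ∂nu, (F : Set (Space d)) ⊆ Metric.closedBall 0 tau)
    (hnu_pos : ∀ᵐ F : Closeds (Space d) ∂nu, 0 < volume (F : Set (Space d)))
    (X : ℕ → Ω → Space d) (C : ℕ → Ω → Closeds (Space d)) (Y : ℕ → ℝ≥0 → Ω → Fin 2)
    (hMPB : IsMPB P lam nu mu0 mu1 X C Y)
    (a u : Space d) (hu : ‖u‖ = 1)
    (p1 beta : ℝ) (hp1 : p1 = mu0 / (mu0 + mu1))
    (hbeta : beta = ∫ F : Closeds (Space d), volume.real (F : Set (Space d)) ∂nu) :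
    ∀ᵐ ω ∂P,
      Tendsto (fun T : ℝ => vacancyTime X C Y a u c T ω / T) atTop
        (𝓝 (Real.exp (-(p1 * lam * beta)))) ∧
      Tendsto (fun T : ℝ => vacancyTime X C Y a u c T ω / (c * T)) atTop
        (𝓝 (Real.exp (-(p1 * lam * beta)) / c)) := by
  have key := hMPB.ae_tendsto_vacancyTime_div (a := a) hlam.le htau.le hmu hc hu hnu_ball
  rw [← hp1, ← hbeta] at key
  filter_upwards [key] with ω hω
  refine ⟨hω, (hω.div_const c).congr fun T => ?_⟩
  rw [div_div, mul_comm T c]
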